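/- **Theorem.** Let $(\Omega,\mathcal F,\mathbb P)$ be a probability space and let $2\le p<\infty$. For a real-valued process $f=(f_n)_{n\ge0}$ put $df_0=f_0$, $df_n=f_n-f_{n-1}$ for $n\ge1$, and $$f^*=\sup_{n\ge0}|f_n|,\qquad \|f\|_p=\sup_{n\ge0}\|f_n\|_p .$$ All norms may be infinite. (i) If $f,g$ are real-valued martingales with respect to the same filtration $(\mathcal F_n)_{n\ge0}$ and $g$ is differentially subordinate to $f$, that is, for every $n\ge0$ one has $|dg_n|\le|df_n|$ almost surely, then $$\|g^*\|_p\le p\,\|f\|_p .$$ (ii) In particular, if $f$ is a real-valued martingale and $g$ is a $\pm1$ transform of $f$, that is, there are deterministic $v_n\in\{-1,1\}$ such that for every $n\ge0$ one has $dg_n=v_n\,df_n$ almost surely, then $$\|g^*\|_p\le p\,\|f^*\|_p .$$ (iii) The constant $p$ is the best possible in (i), and already in (ii). More precisely, suppose that $(\Omega,\mathcal F,\mathbb P)$ is non-atomic (every event of positive probability contains an event of strictly smaller positive probability). Then for every $r<p$ there are a filtration on $\Omega$ and martingales $f,g$ with respect to it such that $g$ is differentially subordinate to $f$ and $\|g^*\|_p>r\,\|f\|_p$;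 and there are a filtration on $\Omega$, a martingale $f$ with respect to it and a $\pm1$ transform $g$ of $f$, also a martingale with respect to that filtration, such that $\|g^*\|_p>r\,\|f^*\|_p$. -/

import Mathlib

open MeasureTheory
open scoped ENNReal

/-- The difference sequence `df` of a process `f`: `df 0 = f 0` and
`df (n + 1) = f (n + 1) - f n`, so that `f n = ∑ k ∈ range (n + 1), df k`. -/
def mdiff {Ω : Type*} (f : ℕ → Ω → ℝ) : ℕ → Ω → ℝ
  | 0 => f 0
  | n + 1 => fun ω => f (n + 1) ω - f n ω

/-- The difference sequence is the one determined by its partial sums. -/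
theorem sum_mdiff {Ω : Type*} (f : ℕ → Ω → ℝ) (n : ℕ) (ω : Ω) :
    ∑ k ∈ Finset.range (n + 1), mdiff f k ω = f n ω := by
  induction n with
  | zero => simp [mdiff]
  | succ n ih => rw [Finset.sum_range_succ, ih]; simp [mdiff]

/-- `g` is differentially subordinate to `f`: for every `n`, `|dg n| ≤ |df n|` almost surely. -/
def DiffSubordinate {Ω : Type*} [MeasurableSpace Ω] (μ : Measure Ω) (g f : ℕ → Ω → ℝ) : Prop :=
  ∀ n, ∀ᵐ ω ∂μ, |mdiff g n ω| ≤ |mdiff f n ω|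

/-- `g` is a `±1` transform of `f`: for some deterministic sequence of signs `v`,
`dg n = v n * df n` almost surely for every `n` (including `n = 0`). -/
def IsSignTransform {Ω : Type*} [MeasurableSpace Ω] (μ : Measure Ω) (g f : ℕ → Ω → ℝ) : Prop :=
  ∃ v : ℕ → ℝ, (∀ n, v n = 1 ∨ v n = -1) ∧
    ∀ n, ∀ᵐ ω ∂μ, mdiff g n ω = v n * mdiff f n ω

/-- The maximal function `f* = sup_{n ≥ 0} |f n|`, with values in `[0, ∞]`. -/
noncomputable def maxFun {Ω : Type*} (f : ℕ → Ω → ℝ) (ω : Ω) : ℝ≥0∞ :=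
  ⨆ n, ENNReal.ofReal |f n ω|

/-- `‖f‖_p = sup_n ‖f n‖_p` for a process `f`, with values in `[0, ∞]`. -/
noncomputable def processNorm {Ω : Type*} [MeasurableSpace Ω] (μ : Measure Ω) (p : ℝ)
    (f : ℕ → Ω → ℝ) : ℝ≥0∞ :=
  ⨆ n, eLpNorm (f n) (ENNReal.ofReal p) μ

/-- `‖f*‖_p`, the `L^p` norm of the maximal function of a process `f`, with values in `[0, ∞]`. -/
noncomputable def maxNorm {Ω : Type*} [MeasurableSpace Ω] (μ : Measure Ω) (p : ℝ)
    (f : ℕ → Ω → ℝ) : ℝ≥0∞ :=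
  eLpNorm (maxFun f) (ENNReal.ofReal p) μ

/-- The measure `μ` is non-atomic: every measurable set of positive measure has a measurable
subset of strictly smaller positive measure. (In general this is stronger than asking only
that singletons be null.) -/
def NonAtomic {Ω : Type*} [MeasurableSpace Ω] (μ : Measure Ω) : Prop :=
  ∀ s, MeasurableSet s → 0 < μ s → ∃ t, t ⊆ s ∧ MeasurableSet t ∧ 0 < μ t ∧ μ t < μ s

/-! The constant factors as `p = (p / (p - 1)) * (p - 1)`: Doob's maximal inequality for `g`, then
Burkholder's inequality between `g` and `f`. Both follow one scheme: a function of the current state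
has nonpositive mean at time 0, its mean does not increase because a tangent inequality bounds each
step by a term linear in the increments, and it controls the difference of `p`-th powers. For Doob
the state is (running maximum, `g n`) and the function `z ^ p - C * z ^ (p - 1) * |y|` with `C = p /
(p - 1)`. For Burkholder the state is `(f n, g n)` and the function `burkholderFun`; its tangent
inequality (`burkholderFun_add_le`) comes from writing it as a minimum over scales of forms that are
quadratic at a fixed scale, and its majorization (`exists_le_mul_burkholderFun`) is a one-variable
inequality.

For sharpness, take nested events `A n` of measure `ρ ^ n`. On `A n` the martingale `g` equals `(1 +
a) ^ n`, and it drops by `b * (1 + a) ^ n` when the path leaves. Alternating the signs of its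
increments makes the growth on `A n` cancel, so `f*` is at most `1 + (a + b) * g*`. If `1 / b < p`,
the norm of `g*` grows geometrically with the number of steps, so the additive `1` is negligible,
and `a + b` may be as close to `1 / p` as desired. -/

theorem rpow_sub_one_eq_mul {p s : ℝ} (hp : 2 ≤ p) (hs : 0 ≤ s) :
    s ^ (p - 1) = s ^ (p - 2) * s := by
  rw [show p - 1 = (p - 2) + 1 by ring, Real.rpow_add_one' hs (by linarith)]

theorem rpow_eq_mul_mul {p s : ℝ} (hp : 2 ≤ p) (hs : 0 ≤ s) :
    s ^ p = s ^ (p - 2) * s * s := by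
  rw [← rpow_sub_one_eq_mul hp hs, ← Real.rpow_add_one' hs (by linarith)]; ring_nf

theorem rpow_eq_rpow_sub_one_mul {p s : ℝ} (hp : 2 ≤ p) (hs : 0 ≤ s) :
    s ^ p = s ^ (p - 1) * s := by
  rw [rpow_eq_mul_mul hp hs, rpow_sub_one_eq_mul hp hs]

/-! ### Burkholder's function and its tangent planes -/

/-- Burkholder's special function for the `L^p` inequality with `2 ≤ p`. -/
noncomputable def burkholderFun (p x y : ℝ) : ℝ :=
  (|y| - (p - 1) * |x|) * (|x| + |y|) ^ (p - 1)

/-- The first slope of a tangent plane to `burkholderFun`. -/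
noncomputable def burkholderDx (p x y : ℝ) : ℝ :=
  -(p * (p - 1) * x * (|x| + |y|) ^ (p - 2))

/-- The second slope of a tangent plane to `burkholderFun`. -/
noncomputable def burkholderDy (p x y : ℝ) : ℝ :=
  p * (if 0 ≤ y then 1 else -1) * (|y| - (p - 2) * |x|) * (|x| + |y|) ^ (p - 2)

/-- A quadratic form in `(x, a)` depending on a scale `s`; its minimum over the admissible scales
is `burkholderFun p x a`. -/
noncomputable def scaleForm (p x a s : ℝ) : ℝ :=
  p * (p - 1) / 2 * (a ^ 2 - x ^ 2) * s ^ (p - 2) - p * (p - 2) * a * s ^ (p - 1)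
    + (p - 1) * (p - 2) / 2 * s ^ p

theorem scaleForm_eq {p x a s : ℝ} (hp : 2 ≤ p) (hs : 0 ≤ s) :
    scaleForm p x a s = (p * (p - 1) / 2 * (a ^ 2 - x ^ 2) - p * (p - 2) * a * s
      + (p - 1) * (p - 2) / 2 * s ^ 2) * s ^ (p - 2) := by
  rw [scaleForm, rpow_sub_one_eq_mul hp hs, rpow_eq_mul_mul hp hs]; ring

theorem burkholderFun_eq_scaleForm {p : ℝ} (hp : 2 ≤ p) (x y : ℝ) :
    burkholderFun p x y = scaleForm p x |y| (|x| + |y|) := by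
  have hs : 0 ≤ |x| + |y| := by positivity
  rw [scaleForm_eq hp hs, burkholderFun, rpow_sub_one_eq_mul hp hs, ← sq_abs x]
  ring

theorem hasDerivAt_scaleForm (p x a : ℝ) {s : ℝ} (hs : 0 < s) :
    HasDerivAt (scaleForm p x a)
      (p * (p - 1) * (p - 2) / 2 * ((a - s) ^ 2 - x ^ 2) * s ^ (p - 3)) s := by
  have h1 := (Real.hasDerivAt_rpow_const (x := s) (p := p - 2) (Or.inl hs.ne')).const_mul
    (p * (p - 1) / 2 * (a ^ 2 - x ^ 2))
  have h2 := (Real.hasDerivAt_rpow_const (x := s) (p := p - 1) (Or.inl hs.ne')).const_mul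
    (p * (p - 2) * a)
  have h3 := (Real.hasDerivAt_rpow_const (x := s) (p := p) (Or.inl hs.ne')).const_mul
    ((p - 1) * (p - 2) / 2)
  have h := (h1.sub h2).add h3
  refine h.congr_deriv ?_
  have e1 : s ^ (p - 2) = s ^ (p - 3) * s := by
    rw [← Real.rpow_add_one hs.ne']; ring_nf
  have e2 : s ^ (p - 1) = s ^ (p - 3) * s * s := by
    rw [← e1, ← Real.rpow_add_one hs.ne']; ring_nf
  rw [show p - 2 - 1 = p - 3 by ring, show p - 1 - 1 = p - 2 by ring, e2, e1]
  ring

theorem continuous_scaleForm {p : ℝ} (hp : 2 ≤ p) (x a : ℝ) : Continuous (scaleForm p x a) := by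
  unfold scaleForm
  have h1 : Continuous fun s : ℝ => s ^ (p - 2) := Real.continuous_rpow_const (by linarith)
  have h2 : Continuous fun s : ℝ => s ^ (p - 1) := Real.continuous_rpow_const (by linarith)
  have h3 : Continuous fun s : ℝ => s ^ p := Real.continuous_rpow_const (by linarith)
  fun_prop

/-- Up to a nonnegative factor the derivative in the scale is `(a - s) ^ 2 - x ^ 2`: nonpositive
between `a - |x|` and `a + |x|`, nonnegative beyond. Scales below `a - |x|` have to be excluded. -/
theorem scaleForm_add_le {p : ℝ} (hp : 2 ≤ p) {x a s : ℝ} (ha : 0 ≤ a) (hs : 0 ≤ s)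
    (has : a - |x| ≤ s) : scaleForm p x a (|x| + a) ≤ scaleForm p x a s := by
  have hx := abs_nonneg x
  have hc : 0 ≤ p * (p - 1) * (p - 2) / 2 := by
    have : 0 ≤ p * (p - 1) * (p - 2) :=
      mul_nonneg (mul_nonneg (by linarith) (by linarith)) (by linarith)
    linarith
  rcases le_total s (|x| + a) with h | h
  · refine antitoneOn_of_deriv_nonpos (convex_Icc s (|x| + a))
      (continuous_scaleForm hp x a).continuousOn ?_ ?_ ⟨le_rfl, h⟩ ⟨h, le_rfl⟩ h
    · intro t ht
      rw [interior_Icc] at ht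
      exact (hasDerivAt_scaleForm p x a (hs.trans_lt ht.1)).differentiableAt.differentiableWithinAt
    · intro t ht
      rw [interior_Icc] at ht
      have ht0 := hs.trans_lt ht.1
      rw [(hasDerivAt_scaleForm p x a ht0).deriv]
      refine mul_nonpos_of_nonpos_of_nonneg (mul_nonpos_of_nonneg_of_nonpos hc ?_) (by positivity)
      rw [← sq_abs x]
      nlinarith [ht.1, ht.2]
  · refine monotoneOn_of_deriv_nonneg (convex_Icc (|x| + a) s)
      (continuous_scaleForm hp x a).continuousOn ?_ ?_ ⟨le_rfl, h⟩ ⟨h, le_rfl⟩ h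
    · intro t ht
      rw [interior_Icc] at ht
      exact (hasDerivAt_scaleForm p x a
        ((add_nonneg hx ha).trans_lt ht.1)).differentiableAt.differentiableWithinAt
    · intro t ht
      rw [interior_Icc] at ht
      have ht0 := (add_nonneg hx ha).trans_lt ht.1
      rw [(hasDerivAt_scaleForm p x a ht0).deriv]
      refine mul_nonneg (mul_nonneg hc ?_) (by positivity)
      rw [← sq_abs x]
      nlinarith [ht.1, ht.2]

/-- Freeze the scale at its old value `|x| + |y|`. The scale form then agrees with Burkholder's
function at the old point and dominates it at the new one. Its second-order part is a nonnegative
multiple of `k ^ 2 - h ^ 2`, and `|y + k|` enters linearly with a nonpositive coefficient, so `y +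
k` may replace it. -/
theorem burkholderFun_le_of_nonneg {p : ℝ} (hp : 2 ≤ p) {x y h k : ℝ} (hy : 0 ≤ y)
    (hk : |k| ≤ |h|) :
    burkholderFun p (x + h) (y + k)
      ≤ burkholderFun p x y + burkholderDx p x y * h + burkholderDy p x y * k := by
  have hs : 0 ≤ |x| + |y| := by positivity
  have hT : 0 ≤ (|x| + |y|) ^ (p - 2) := by positivity
  -- The old scale is admissible at the new point, since `|k| ≤ |h| ≤ |x + h| + |x|`.
  have h1 : |y + k| - |x + h| ≤ |x| + |y| := by
    have := abs_add_le y k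
    have h3 := abs_sub (x + h) x
    rw [add_sub_cancel_left] at h3
    linarith
  rw [burkholderFun_eq_scaleForm hp]
  refine (scaleForm_add_le hp (abs_nonneg _) hs h1).trans ?_
  rw [scaleForm_eq hp hs, burkholderFun, rpow_sub_one_eq_mul hp hs, burkholderDx, burkholderDy,
    if_pos hy, sq_abs, abs_of_nonneg hy] at *
  have hkh : k ^ 2 ≤ h ^ 2 := sq_le_sq.2 hk
  have hyk : y + k ≤ |y + k| := le_abs_self _
  have key : p * (p - 1) / 2 * ((y + k) ^ 2 - (x + h) ^ 2) - p * (p - 2) * |y + k| * (|x| + y)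
      + (p - 1) * (p - 2) / 2 * (|x| + y) ^ 2
      ≤ (y - (p - 1) * |x|) * (|x| + y) - p * (p - 1) * x * h + p * (y - (p - 2) * |x|) * k := by
    have e1 : 0 ≤ p * (p - 1) / 2 * (h ^ 2 - k ^ 2) :=
      mul_nonneg (by nlinarith) (by linarith)
    have e2 : 0 ≤ p * (p - 2) * (|x| + y) * (|y + k| - (y + k)) :=
      mul_nonneg (mul_nonneg (mul_nonneg (by linarith) (by linarith)) hs) (by linarith)
    linear_combination e1 + e2 + p * (p - 1) / 2 * sq_abs x
  have := mul_le_mul_of_nonneg_right key hT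
  refine this.trans (le_of_eq ?_)
  ring

/-- Concavity of Burkholder's function along the lines of slope at most one, in the form of a
tangent plane inequality. -/
theorem burkholderFun_add_le {p : ℝ} (hp : 2 ≤ p) {x y h k : ℝ} (hk : |k| ≤ |h|) :
    burkholderFun p (x + h) (y + k)
      ≤ burkholderFun p x y + burkholderDx p x y * h + burkholderDy p x y * k := by
  rcases le_or_gt 0 y with hy | hy
  · exact burkholderFun_le_of_nonneg hp hy hk
  · have := burkholderFun_le_of_nonneg hp (x := x) (y := -y) (h := h) (k := -k) (by linarith)
      (by rwa [abs_neg])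
    rw [← neg_add] at this
    simp only [burkholderFun, burkholderDx, burkholderDy, abs_neg, if_neg hy.not_ge,
      if_pos (neg_nonneg.2 hy.le)] at this ⊢
    linarith

theorem burkholderFun_nonpos {p : ℝ} (hp : 2 ≤ p) {x y : ℝ} (h : |y| ≤ |x|) :
    burkholderFun p x y ≤ 0 := by
  refine mul_nonpos_of_nonpos_of_nonneg ?_ (by positivity)
  nlinarith [abs_nonneg x]

/-- Gives integrability of a slope of order `p - 1` times an increment when both come from `L^p`. -/
theorem rpow_sub_mul_le_max {p a b : ℝ} (hp : 2 ≤ p) (ha : 0 ≤ a) (hb : 0 ≤ b) :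
    a ^ (p - 1) * b ≤ a ^ p + b ^ p := by
  have h1 : a ^ (p - 1) * b ≤ max a b ^ p := by
    rw [rpow_eq_rpow_sub_one_mul hp (ha.trans (le_max_left a b))]
    gcongr
    · linarith
    · exact le_max_left _ _
    · exact le_max_right _ _
  refine h1.trans ?_
  rcases max_choice a b with h | h <;> rw [h] <;> linarith [Real.rpow_nonneg ha p, Real.rpow_nonneg hb p]

theorem abs_burkholderFun_le {p : ℝ} (hp : 2 ≤ p) (x y : ℝ) :
    |burkholderFun p x y| ≤ p * (|x| + |y|) ^ p := by
  have hs : 0 ≤ |x| + |y| := by positivity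
  have hT : 0 ≤ (|x| + |y|) ^ (p - 1) := by positivity
  rw [burkholderFun, abs_mul, abs_of_nonneg hT, rpow_eq_rpow_sub_one_mul hp hs]
  have : |(|y| - (p - 1) * |x|)| ≤ p * (|x| + |y|) := by
    rw [abs_le]; constructor <;> nlinarith [abs_nonneg x, abs_nonneg y]
  nlinarith

theorem abs_burkholderDx_le {p : ℝ} (hp : 2 ≤ p) (x y : ℝ) :
    |burkholderDx p x y| ≤ p ^ 2 * (|x| + |y|) ^ (p - 1) := by
  have hs : 0 ≤ |x| + |y| := by positivity
  have hT : 0 ≤ (|x| + |y|) ^ (p - 2) := by positivity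
  rw [burkholderDx, abs_neg, abs_mul, abs_of_nonneg hT, rpow_sub_one_eq_mul hp hs, abs_mul,
    abs_of_nonneg (show 0 ≤ p * (p - 1) by nlinarith)]
  have : p * (p - 1) * |x| ≤ p ^ 2 * (|x| + |y|) := by
    have h1 : 0 ≤ p * |x| := mul_nonneg (by linarith) (abs_nonneg x)
    have h2 : 0 ≤ p ^ 2 * |y| := by positivity
    nlinarith
  nlinarith

theorem abs_burkholderDy_le {p : ℝ} (hp : 2 ≤ p) (x y : ℝ) :
    |burkholderDy p x y| ≤ p ^ 2 * (|x| + |y|) ^ (p - 1) := by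
  have hs : 0 ≤ |x| + |y| := by positivity
  have hT : 0 ≤ (|x| + |y|) ^ (p - 2) := by positivity
  have h1 : |(if 0 ≤ y then (1 : ℝ) else -1)| = 1 := by split_ifs <;> simp
  rw [burkholderDy, abs_mul, abs_of_nonneg hT, rpow_sub_one_eq_mul hp hs, abs_mul, abs_mul, h1,
    abs_of_nonneg (show 0 ≤ p by linarith), mul_one]
  have : |(|y| - (p - 2) * |x|)| ≤ p * (|x| + |y|) := by
    rw [abs_le]; constructor <;> nlinarith [abs_nonneg x, abs_nonneg y]
  have h2 : p * |(|y| - (p - 2) * |x|)| ≤ p ^ 2 * (|x| + |y|) := by nlinarith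
  nlinarith

/-! ### Majorization and Young's inequality -/

/-- The derivative of the right side is `p * (1 - t)` times the difference of `(1 - t / p) ^ (p -
2)` and `(1 - t) ^ (p - 2)`. It is nonpositive for `t ≤ 0` and nonnegative for `0 ≤ t`, so the
minimum is the value `1` at `0`. -/
theorem one_sub_rpow_le {p : ℝ} (hp : 2 ≤ p) {d : ℝ} (hd : d ≤ 1) :
    1 ≤ p * d * (1 - d / p) ^ (p - 1) + (1 - d) ^ p := by
  set F : ℝ → ℝ := fun d => p * d * (1 - d / p) ^ (p - 1) + (1 - d) ^ p with hF
  have hp0 : 0 < p := by linarith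
  have hpos : ∀ t : ℝ, t < 1 → 0 < 1 - t / p := by
    intro t ht
    have : t / p < 1 := by rw [div_lt_one hp0]; linarith
    linarith
  have hcont : Continuous F := by
    have h1 : Continuous fun s : ℝ => (1 - s / p) ^ (p - 1) :=
      (continuous_const.sub (continuous_id.div_const p)).rpow_const fun _ => Or.inr (by linarith)
    have h2 : Continuous fun s : ℝ => (1 - s) ^ p :=
      (continuous_const.sub continuous_id).rpow_const fun _ => Or.inr (by linarith)
    fun_prop
  have hder : ∀ t : ℝ, t < 1 → HasDerivAt F
      (p * (1 - t) * ((1 - t / p) ^ (p - 2) - (1 - t) ^ (p - 2))) t := by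
    intro t ht
    have h0 := hpos t ht
    have a1 : HasDerivAt (fun s : ℝ => 1 - s / p) (-(1 / p)) t :=
      ((hasDerivAt_id t).div_const p).const_sub 1
    have a2 : HasDerivAt (fun s : ℝ => 1 - s) (-1) t := (hasDerivAt_id t).const_sub 1
    have b1 := a1.rpow_const (p := p - 1) (Or.inl h0.ne')
    have b2 := a2.rpow_const (p := p) (Or.inl (by linarith))
    have b3 : HasDerivAt (fun s : ℝ => p * s) (p * 1) t := (hasDerivAt_id t).const_mul p
    refine ((b3.mul b1).add b2).congr_deriv ?_
    rw [show p - 1 - 1 = p - 2 by ring, rpow_sub_one_eq_mul hp h0.le,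
      rpow_sub_one_eq_mul hp (show 0 ≤ 1 - t by linarith)]
    field_simp
    ring
  have hF0 : F 0 = 1 := by simp [hF]
  change 1 ≤ F d
  rw [← hF0]
  rcases le_total d 0 with h | h
  · refine antitoneOn_of_deriv_nonpos (convex_Icc d 0) hcont.continuousOn ?_ ?_ ⟨le_rfl, h⟩
      ⟨h, le_rfl⟩ h
    · intro t ht
      rw [interior_Icc] at ht
      exact (hder t (by linarith [ht.2])).differentiableAt.differentiableWithinAt
    · intro t ht
      rw [interior_Icc] at ht
      have h0 := hpos t (by linarith [ht.2])
      rw [(hder t (by linarith [ht.2])).deriv]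
      refine mul_nonpos_of_nonneg_of_nonpos (mul_nonneg hp0.le (by linarith [ht.2])) ?_
      refine sub_nonpos.2 (Real.rpow_le_rpow h0.le ?_ (by linarith))
      have : t ≤ t / p := by rw [le_div_iff₀ hp0]; nlinarith [ht.2]
      linarith
  · refine monotoneOn_of_deriv_nonneg (convex_Icc 0 d) hcont.continuousOn ?_ ?_ ⟨le_rfl, h⟩
      ⟨h, le_rfl⟩ h
    · intro t ht
      rw [interior_Icc] at ht
      exact (hder t (by linarith [ht.2])).differentiableAt.differentiableWithinAt
    · intro t ht
      rw [interior_Icc] at ht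
      have ht1 : t < 1 := by linarith [ht.2]
      rw [(hder t ht1).deriv]
      refine mul_nonneg (mul_nonneg hp0.le (by linarith)) ?_
      refine sub_nonneg.2 (Real.rpow_le_rpow (by linarith) ?_ (by linarith))
      have : t / p ≤ t := by rw [div_le_iff₀ hp0]; nlinarith [ht.1]
      linarith

/-- The homogeneous form of `one_sub_rpow_le`, with `d = 1 - x / v`. The weights of the mean are
such that `v = |y| / (p - 1)` turns it into `(|y| + x) / p`, the sum occurring in Burkholder's
function. -/
theorem rpow_sub_rpow_le {p : ℝ} (hp : 2 ≤ p) {v x : ℝ} (hv : 0 ≤ v) (hx : 0 ≤ x) :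
    v ^ p - x ^ p ≤ p * (v - x) * (((p - 1) * v + x) / p) ^ (p - 1) := by
  have hp0 : 0 < p := by linarith
  rcases hv.eq_or_lt with rfl | hv
  · rw [Real.zero_rpow hp0.ne', mul_zero, zero_add, zero_sub, zero_sub,
      Real.div_rpow hx hp0.le, rpow_eq_rpow_sub_one_mul hp hx]
    have h1 : p ≤ p ^ (p - 1) := by
      conv_lhs => rw [← Real.rpow_one p]
      exact Real.rpow_le_rpow_of_exponent_le (by linarith) (by linarith)
    have h2 : p * (x ^ (p - 1) / p ^ (p - 1)) ≤ x ^ (p - 1) := by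
      rw [mul_div_assoc', div_le_iff₀ (by positivity), mul_comm]
      gcongr
    nlinarith
  · have h := one_sub_rpow_le hp (d := 1 - x / v) (sub_le_self 1 (by positivity))
    have e1 : 1 - (1 - x / v) / p = ((p - 1) * v + x) / p / v := by field_simp; ring
    have e2 : 1 - (1 - x / v) = x / v := by ring
    have hm : 0 ≤ ((p - 1) * v + x) / p :=
      div_nonneg (add_nonneg (mul_nonneg (by linarith) hv.le) hx) hp0.le
    rw [e1, e2, Real.div_rpow hm hv.le, Real.div_rpow hx hv.le] at h
    have hvp : 0 < v ^ (p - 1) := by positivity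
    rw [rpow_eq_rpow_sub_one_mul hp hv.le] at h ⊢
    have h2 := mul_le_mul_of_nonneg_left h (mul_pos hvp hv).le
    have e3 : v ^ (p - 1) * v * (p * (1 - x / v) * ((((p - 1) * v + x) / p) ^ (p - 1) / v ^ (p - 1))
      + x ^ p / (v ^ (p - 1) * v)) = p * (v - x) * (((p - 1) * v + x) / p) ^ (p - 1) + x ^ p := by
      field_simp
    rw [e3] at h2
    linarith

/-- Burkholder's function majorizes a multiple of `|y| ^ p - (p - 1) ^ p * |x| ^ p`. -/
theorem exists_le_mul_burkholderFun {p : ℝ} (hp : 2 ≤ p) :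
    ∃ c : ℝ, 0 ≤ c ∧ ∀ x y : ℝ,
      |y| ^ p - (p - 1) ^ p * |x| ^ p ≤ c * burkholderFun p x y := by
  have hp0 : 0 < p := by linarith
  have hp1 : 0 < p - 1 := by linarith
  -- The constant left after putting `v = |y| / (p - 1)` and multiplying by `(p - 1) ^ p`.
  refine ⟨(p - 1) ^ (p - 1) * p / p ^ (p - 1), by positivity, fun x y => ?_⟩
  have h := rpow_sub_rpow_le hp (v := |y| / (p - 1)) (x := |x|) (by positivity) (abs_nonneg x)
  rw [mul_div_cancel₀ _ hp1.ne', Real.div_rpow (abs_nonneg y) hp1.le,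
    Real.div_rpow (by positivity) hp0.le] at h
  have hP : 0 < (p - 1) ^ p := by positivity
  have h2 := mul_le_mul_of_nonneg_left h hP.le
  have e1 : (p - 1) ^ p * (|y| ^ p / (p - 1) ^ p - |x| ^ p)
      = |y| ^ p - (p - 1) ^ p * |x| ^ p := by field_simp
  rw [e1] at h2
  refine h2.trans (le_of_eq ?_)
  rw [burkholderFun, rpow_eq_rpow_sub_one_mul hp hp1.le, add_comm |y| |x|]
  field_simp

theorem mul_rpow_mul_le {p : ℝ} (hp : 2 ≤ p) {z w : ℝ} (hz : 0 ≤ z) (hw : 0 ≤ w) :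
    p * (z ^ (p - 1) * w) ≤ w ^ p + (p - 1) * z ^ p := by
  have hp0 : 0 < p := by linarith
  have hp1 : 0 < p - 1 := by linarith
  have h := Real.young_inequality_of_nonneg hw (Real.rpow_nonneg hz (p - 1))
    (Real.HolderConjugate.conjExponent (show 1 < p by linarith))
  rw [← Real.rpow_mul hz, Real.conjExponent, mul_div_cancel₀ _ hp1.ne'] at h
  have h2 := mul_le_mul_of_nonneg_left h hp0.le
  have e : p * (w ^ p / p + z ^ p / (p / (p - 1))) = w ^ p + (p - 1) * z ^ p := by field_simp
  rw [e] at h2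
  linarith

/-! ### Integrals against martingale increments, and `L^p` tools -/

/-- Pull `H` out of the conditional expectation. This removes the linear terms of every tangent
inequality below. -/
theorem integral_mul_sub_eq_zero {Ω : Type*} [m0 : MeasurableSpace Ω] {μ : Measure Ω}
    [IsProbabilityMeasure μ] {ℱ : Filtration ℕ m0} {f : ℕ → Ω → ℝ} (hf : Martingale f ℱ μ) (n : ℕ)
    {H : Ω → ℝ} (hH : StronglyMeasurable[ℱ n] H)
    (hi : Integrable (fun ω => H ω * (f (n + 1) ω - f n ω)) μ) :
    ∫ ω, H ω * (f (n + 1) ω - f n ω) ∂μ = 0 := by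
  have hd : Integrable (f (n + 1) - f n) μ := (hf.integrable _).sub (hf.integrable _)
  have h1 : μ[H * (f (n + 1) - f n) | ℱ n] =ᵐ[μ] H * μ[f (n + 1) - f n | ℱ n] :=
    condExp_mul_of_stronglyMeasurable_left hH hi hd
  have h2 : μ[f (n + 1) - f n | ℱ n] =ᵐ[μ] 0 := by
    have h3 := condExp_sub (hf.integrable (n + 1)) (hf.integrable n) (ℱ n)
    filter_upwards [h3, hf.2 n (n + 1) (Nat.le_succ n), hf.2 n n le_rfl] with ω a b c
    rw [a, Pi.sub_apply, b, c, sub_self, Pi.zero_apply]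
  calc ∫ ω, H ω * (f (n + 1) ω - f n ω) ∂μ = ∫ ω, (μ[H * (f (n + 1) - f n) | ℱ n]) ω ∂μ :=
        (integral_condExp (ℱ.le n)).symm
    _ = ∫ _, (0 : ℝ) ∂μ := by
        refine integral_congr_ae ?_
        filter_upwards [h1, h2] with ω a b
        rw [a, Pi.mul_apply, b, Pi.zero_apply, mul_zero]
    _ = 0 := by simp

section Lp

variable {Ω : Type*} [m0 : MeasurableSpace Ω] {μ : Measure Ω} {p : ℝ}

theorem integrable_abs_rpow (hp : 2 ≤ p) {f : Ω → ℝ} (hf : MemLp f (ENNReal.ofReal p) μ) :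
    Integrable (fun ω => |f ω| ^ p) μ := by
  have h := hf.integrable_norm_rpow (by simp; linarith) ENNReal.ofReal_ne_top
  rwa [ENNReal.toReal_ofReal (by linarith)] at h

theorem integrable_of_abs_le_rpow (hp : 2 ≤ p) {s F : Ω → ℝ} {C : ℝ}
    (hs : MemLp s (ENNReal.ofReal p) μ) (hF : AEStronglyMeasurable F μ)
    (h : ∀ ω, |F ω| ≤ C * |s ω| ^ p) : Integrable F μ :=
  ((integrable_abs_rpow hp hs).const_mul C).mono' hF (Filter.Eventually.of_forall h)

theorem integrable_of_abs_le_rpow_mul (hp : 2 ≤ p) {s d F : Ω → ℝ} {C : ℝ} (hC : 0 ≤ C)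
    (hs : MemLp s (ENNReal.ofReal p) μ) (hd : MemLp d (ENNReal.ofReal p) μ)
    (hF : AEStronglyMeasurable F μ) (h : ∀ ω, |F ω| ≤ C * (|s ω| ^ (p - 1) * |d ω|)) :
    Integrable F μ :=
  (((integrable_abs_rpow hp hs).add (integrable_abs_rpow hp hd)).const_mul C).mono' hF
    (Filter.Eventually.of_forall fun ω => (h ω).trans
      (mul_le_mul_of_nonneg_left (rpow_sub_mul_le_max hp (abs_nonneg _) (abs_nonneg _)) hC))

theorem eLpNorm_le_mul_of_integral_rpow_le (hp : 2 ≤ p) {F G : Ω → ℝ} {c : ℝ} (hc : 0 ≤ c)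
    (hF : MemLp F (ENNReal.ofReal p) μ) (hG : MemLp G (ENNReal.ofReal p) μ)
    (h : ∫ ω, |G ω| ^ p ∂μ ≤ c ^ p * ∫ ω, |F ω| ^ p ∂μ) :
    eLpNorm G (ENNReal.ofReal p) μ ≤ ENNReal.ofReal c * eLpNorm F (ENNReal.ofReal p) μ := by
  have hp0 : 0 < p := by linarith
  rw [hG.eLpNorm_eq_integral_rpow_norm (by simp; linarith) ENNReal.ofReal_ne_top,
    hF.eLpNorm_eq_integral_rpow_norm (by simp; linarith) ENNReal.ofReal_ne_top,
    ENNReal.toReal_ofReal hp0.le, ← ENNReal.ofReal_mul hc]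
  refine ENNReal.ofReal_le_ofReal ?_
  have hI : 0 ≤ ∫ ω, |F ω| ^ p ∂μ := integral_nonneg fun ω => by positivity
  have hJ : 0 ≤ ∫ ω, |G ω| ^ p ∂μ := integral_nonneg fun ω => by positivity
  refine (Real.rpow_le_rpow hJ h (by positivity)).trans (le_of_eq ?_)
  rw [Real.mul_rpow (by positivity) hI, ← Real.rpow_mul hc, mul_inv_cancel₀ hp0.ne', Real.rpow_one]
  rfl

end Lp

theorem measurable_burkholderFun {p : ℝ} :
    Measurable fun z : ℝ × ℝ => burkholderFun p z.1 z.2 := by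
  unfold burkholderFun
  fun_prop

theorem measurable_burkholderDx {p : ℝ} :
    Measurable fun z : ℝ × ℝ => burkholderDx p z.1 z.2 := by
  unfold burkholderDx
  fun_prop

theorem measurable_burkholderDy {p : ℝ} :
    Measurable fun z : ℝ × ℝ => burkholderDy p z.1 z.2 := by
  unfold burkholderDy
  have : Measurable fun z : ℝ × ℝ => if 0 ≤ z.2 then (1 : ℝ) else -1 :=
    Measurable.ite (measurableSet_le measurable_const measurable_snd) measurable_const
      measurable_const
  fun_prop

/-! ### The running maximum and the passage to `maxNorm` -/

/-- The running maximum `max_{k ≤ n} |g k|`. -/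
def runMax {Ω : Type*} (g : ℕ → Ω → ℝ) : ℕ → Ω → ℝ
  | 0 => fun ω => |g 0 ω|
  | n + 1 => fun ω => max (runMax g n ω) |g (n + 1) ω|

theorem abs_le_runMax {Ω : Type*} (g : ℕ → Ω → ℝ) (n : ℕ) (ω : Ω) : |g n ω| ≤ runMax g n ω := by
  cases n with
  | zero => exact le_rfl
  | succ n => exact le_max_right _ _

theorem runMax_nonneg {Ω : Type*} (g : ℕ → Ω → ℝ) (n : ℕ) (ω : Ω) : 0 ≤ runMax g n ω :=
  (abs_nonneg _).trans (abs_le_runMax g n ω)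

theorem monotone_runMax {Ω : Type*} (g : ℕ → Ω → ℝ) (ω : Ω) : Monotone fun n => runMax g n ω :=
  monotone_nat_of_le_succ fun _ => le_max_left _ _

theorem memLp_runMax {Ω : Type*} [MeasurableSpace Ω] {μ : Measure Ω} {q : ℝ≥0∞} {g : ℕ → Ω → ℝ}
    (hg : ∀ n, MemLp (g n) q μ) (n : ℕ) : MemLp (runMax g n) q μ := by
  induction n with
  | zero => exact (hg 0).abs
  | succ n ih => exact ih.sup (hg (n + 1)).abs

theorem measurable_runMax {Ω : Type*} {m0 : MeasurableSpace Ω} {ℱ : Filtration ℕ m0}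
    {g : ℕ → Ω → ℝ} (hg : ∀ n, Measurable[ℱ n] (g n)) (n : ℕ) : Measurable[ℱ n] (runMax g n) := by
  induction n with
  | zero => exact measurable_abs.comp (hg 0)
  | succ n ih =>
    exact Measurable.max (ih.mono (ℱ.mono (Nat.le_succ n)) le_rfl)
      (measurable_abs.comp (hg (n + 1)))

section Norms

variable {Ω : Type*} [m0 : MeasurableSpace Ω] {μ : Measure Ω} {p : ℝ} {f g : ℕ → Ω → ℝ}

theorem IsSignTransform.diffSubordinate (h : IsSignTransform μ g f) :
    DiffSubordinate μ g f := by
  obtain ⟨v, hv, hgv⟩ := h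
  intro n
  filter_upwards [hgv n] with ω hω
  rw [hω, abs_mul]
  rcases hv n with h | h <;> simp [h]

theorem memLp_of_diffSubordinate {q : ℝ≥0∞} (hf : ∀ n, MemLp (f n) q μ)
    (hg : ∀ n, AEStronglyMeasurable (g n) μ) (hs : DiffSubordinate μ g f) (n : ℕ) :
    MemLp (g n) q μ := by
  induction n with
  | zero => exact (hf 0).mono (hg 0) (hs 0)
  | succ n ih =>
    have h : MemLp (g (n + 1) - g n) q μ :=
      ((hf (n + 1)).sub (hf n)).mono ((hg (n + 1)).sub (hg n)) (hs (n + 1))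
    simpa using ih.add h

/-- Monotone convergence for the `p`-th powers of the running maxima. -/
theorem maxNorm_le_of_eLpNorm_runMax_le (hp : 2 ≤ p) (hg : ∀ n, Measurable (runMax g n))
    {K : ℝ≥0∞} (h : ∀ n, eLpNorm (runMax g n) (ENNReal.ofReal p) μ ≤ K) :
    maxNorm μ p g ≤ K := by
  have hp0 : 0 < p := by linarith
  have hP0 : ENNReal.ofReal p ≠ 0 := by simp; linarith
  have hle : ∀ F : Ω → ℝ≥0∞, eLpNorm F (ENNReal.ofReal p) μ ≤ K ↔ ∫⁻ ω, F ω ^ p ∂μ ≤ K ^ p := by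
    intro F
    rw [eLpNorm_eq_lintegral_rpow_enorm_toReal hP0 ENNReal.ofReal_ne_top,
      ENNReal.toReal_ofReal hp0.le, one_div, ENNReal.rpow_inv_le_iff hp0]
    rfl
  have h' : ∀ n, ∫⁻ ω, ENNReal.ofReal (runMax g n ω) ^ p ∂μ ≤ K ^ p := by
    intro n
    rw [← hle]
    refine le_trans (le_of_eq ?_) (h n)
    refine eLpNorm_congr_enorm_ae (Filter.Eventually.of_forall fun ω => ?_)
    rw [Real.enorm_of_nonneg (runMax_nonneg g n ω)]
    rfl
  rw [maxNorm, hle]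
  calc ∫⁻ ω, maxFun g ω ^ p ∂μ ≤ ∫⁻ ω, ⨆ n, ENNReal.ofReal (runMax g n ω) ^ p ∂μ := by
        refine lintegral_mono fun ω => ?_
        rw [maxFun, (ENNReal.monotone_rpow_of_nonneg hp0.le).map_iSup_of_continuousAt
          ENNReal.continuous_rpow_const.continuousAt (by simp [hp0])]
        refine iSup_mono fun n => ?_
        gcongr
        exact abs_le_runMax g n ω
    _ = ⨆ n, ∫⁻ ω, ENNReal.ofReal (runMax g n ω) ^ p ∂μ := by
        refine lintegral_iSup (fun n => (hg n).ennreal_ofReal.pow_const p) fun i j hij ω => ?_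
        dsimp only
        gcongr
        exact monotone_runMax g ω hij
    _ ≤ K ^ p := iSup_le h'

theorem processNorm_le_maxNorm : processNorm μ p f ≤ maxNorm μ p f := by
  refine iSup_le fun n => ?_
  refine eLpNorm_mono_enorm fun ω => ?_
  rw [enorm_eq_self, Real.enorm_eq_ofReal_abs]
  exact le_iSup (fun n => ENNReal.ofReal |f n ω|) n

end Norms

/-! ### The inequalities of Burkholder and Doob -/

section Bounds

variable {Ω : Type*} [m0 : MeasurableSpace Ω] {μ : Measure Ω} [IsProbabilityMeasure μ] {p : ℝ}
  {ℱ : Filtration ℕ m0} {f g : ℕ → Ω → ℝ}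

theorem integral_burkholderFun_nonpos (hp : 2 ≤ p) (hf : Martingale f ℱ μ)
    (hg : Martingale g ℱ μ) (hs : DiffSubordinate μ g f)
    (hfp : ∀ n, MemLp (f n) (ENNReal.ofReal p) μ) (hgp : ∀ n, MemLp (g n) (ENNReal.ofReal p) μ)
    (n : ℕ) :
    Integrable (fun ω => burkholderFun p (f n ω) (g n ω)) μ ∧
      ∫ ω, burkholderFun p (f n ω) (g n ω) ∂μ ≤ 0 := by
  have hfg : ∀ n, MemLp (fun ω => |f n ω| + |g n ω|) (ENNReal.ofReal p) μ :=
    fun n => (hfp n).abs.add (hgp n).abs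
  have hm : ∀ n, Measurable[ℱ n] fun ω => (f n ω, g n ω) := fun n =>
    (hf.1 n).measurable.prodMk (hg.1 n).measurable
  have hU : ∀ n, Integrable (fun ω => burkholderFun p (f n ω) (g n ω)) μ := fun n =>
    integrable_of_abs_le_rpow hp (hfg n)
      ((measurable_burkholderFun.comp (hm n)).mono (ℱ.le n) le_rfl).aestronglyMeasurable fun ω => by
        rw [abs_of_nonneg (show 0 ≤ |f n ω| + |g n ω| by positivity)]
        exact abs_burkholderFun_le hp _ _
  refine ⟨hU n, ?_⟩
  induction n with
  | zero =>
    refine integral_nonpos_of_ae ?_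
    filter_upwards [hs 0] with ω h
    exact burkholderFun_nonpos hp h
  | succ n ih =>
    have hA : StronglyMeasurable[ℱ n] fun ω => burkholderDx p (f n ω) (g n ω) :=
      (measurable_burkholderDx.comp (hm n)).stronglyMeasurable
    have hB : StronglyMeasurable[ℱ n] fun ω => burkholderDy p (f n ω) (g n ω) :=
      (measurable_burkholderDy.comp (hm n)).stronglyMeasurable
    have hAi : Integrable (fun ω => burkholderDx p (f n ω) (g n ω) * (f (n + 1) ω - f n ω)) μ :=
      integrable_of_abs_le_rpow_mul hp (sq_nonneg p) (hfg n) ((hfp (n + 1)).sub (hfp n))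
        ((hA.mono (ℱ.le n)).aestronglyMeasurable.mul ((hfp (n + 1)).sub (hfp n)).1) fun ω => by
          rw [abs_of_nonneg (show 0 ≤ |f n ω| + |g n ω| by positivity), abs_mul, ← mul_assoc]
          exact mul_le_mul_of_nonneg_right (abs_burkholderDx_le hp _ _) (abs_nonneg _)
    have hBi : Integrable (fun ω => burkholderDy p (f n ω) (g n ω) * (g (n + 1) ω - g n ω)) μ :=
      integrable_of_abs_le_rpow_mul hp (sq_nonneg p) (hfg n) ((hgp (n + 1)).sub (hgp n))
        ((hB.mono (ℱ.le n)).aestronglyMeasurable.mul ((hgp (n + 1)).sub (hgp n)).1) fun ω => by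
          rw [abs_of_nonneg (show 0 ≤ |f n ω| + |g n ω| by positivity), abs_mul, ← mul_assoc]
          exact mul_le_mul_of_nonneg_right (abs_burkholderDy_le hp _ _) (abs_nonneg _)
    have h1 := integral_mul_sub_eq_zero hf n hA hAi
    have h2 := integral_mul_sub_eq_zero hg n hB hBi
    calc ∫ ω, burkholderFun p (f (n + 1) ω) (g (n + 1) ω) ∂μ
        ≤ ∫ ω, (burkholderFun p (f n ω) (g n ω)
            + burkholderDx p (f n ω) (g n ω) * (f (n + 1) ω - f n ω))
            + burkholderDy p (f n ω) (g n ω) * (g (n + 1) ω - g n ω) ∂μ := by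
          refine integral_mono_ae (hU (n + 1)) (((hU n).add hAi).add hBi) ?_
          filter_upwards [hs (n + 1)] with ω h
          have := burkholderFun_add_le hp (x := f n ω) (y := g n ω) h
          simpa only [mdiff, add_sub_cancel] using this
      _ = ∫ ω, burkholderFun p (f n ω) (g n ω) ∂μ := by
          refine (integral_add ((hU n).add hAi) hBi).trans ?_
          rw [h2, add_zero]
          exact (integral_add (hU n) hAi).trans (by rw [h1, add_zero])
      _ ≤ 0 := ih

/-- Burkholder's inequality for differentially subordinate martingales, `2 ≤ p`. -/
theorem integral_rpow_le_of_diffSubordinate (hp : 2 ≤ p) (hf : Martingale f ℱ μ)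
    (hg : Martingale g ℱ μ) (hs : DiffSubordinate μ g f)
    (hfp : ∀ n, MemLp (f n) (ENNReal.ofReal p) μ) (hgp : ∀ n, MemLp (g n) (ENNReal.ofReal p) μ)
    (n : ℕ) : ∫ ω, |g n ω| ^ p ∂μ ≤ (p - 1) ^ p * ∫ ω, |f n ω| ^ p ∂μ := by
  obtain ⟨c, hc, h⟩ := exists_le_mul_burkholderFun hp
  obtain ⟨hi, hle⟩ := integral_burkholderFun_nonpos hp hf hg hs hfp hgp n
  have hfi := integrable_abs_rpow hp (hfp n)
  have hgi := integrable_abs_rpow hp (hgp n)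
  have := integral_mono (hgi.sub (hfi.const_mul ((p - 1) ^ p))) (hi.const_mul c)
    fun ω => h (f n ω) (g n ω)
  rw [integral_const_mul, integral_sub' hgi (hfi.const_mul _), integral_const_mul] at this
  nlinarith

/-- Doob's `L^p` inequality for martingales, `2 ≤ p`. -/
theorem integral_runMax_rpow_le (hp : 2 ≤ p) (hg : Martingale g ℱ μ)
    (hgp : ∀ n, MemLp (g n) (ENNReal.ofReal p) μ) (n : ℕ) :
    ∫ ω, |runMax g n ω| ^ p ∂μ ≤ (p / (p - 1)) ^ p * ∫ ω, |g n ω| ^ p ∂μ := by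
  have hp0 : 0 < p := by linarith
  have hp1 : 0 < p - 1 := by linarith
  set C : ℝ := p / (p - 1) with hC
  have hC0 : 0 < C := by positivity
  have hMp := memLp_runMax hgp
  have hMm : ∀ n, Measurable[ℱ n] (runMax g n) :=
    measurable_runMax fun n => (hg.1 n).measurable
  have hM0 := runMax_nonneg g
  have hMi : ∀ n, Integrable (fun ω => runMax g n ω ^ p) μ := fun n => by
    simpa only [abs_of_nonneg (hM0 n _)] using integrable_abs_rpow hp (hMp n)
  have hMM : ∀ n k, Integrable (fun ω => runMax g n ω ^ (p - 1) * |g k ω|) μ := fun n k =>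
    integrable_of_abs_le_rpow_mul hp zero_le_one (hMp n) (hgp k)
      ((((hMm n).mono (ℱ.le n) le_rfl).pow_const (p - 1)).aestronglyMeasurable.mul
        (hgp k).abs.1) fun ω => by
        rw [one_mul, abs_mul, abs_abs, abs_of_nonneg (hM0 n ω),
          abs_of_nonneg (Real.rpow_nonneg (hM0 n ω) _)]
  have hD : ∀ n k, Integrable
      (fun ω => runMax g n ω ^ p - C * (runMax g n ω ^ (p - 1) * |g k ω|)) μ := fun n k =>
    (hMi n).sub ((hMM n k).const_mul C)
  -- At time 0 the integrand is `(1 - C) * |g 0| ^ p`. Afterwards its mean does not increase: `|g (n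
  -- + 1)|` is bounded below by its tangent at `g n`, whose slope is a sign of `g n`.
  have main : ∫ ω, (runMax g n ω ^ p - C * (runMax g n ω ^ (p - 1) * |g n ω|)) ∂μ ≤ 0 := by
    induction n with
    | zero =>
      refine integral_nonpos fun ω => ?_
      change |g 0 ω| ^ p - C * (|g 0 ω| ^ (p - 1) * |g 0 ω|) ≤ 0
      rw [← rpow_eq_rpow_sub_one_mul hp (abs_nonneg _)]
      have h1 : 1 ≤ C := by rw [hC, one_le_div hp1]; linarith
      nlinarith [Real.rpow_nonneg (abs_nonneg (g 0 ω)) p]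
    | succ n ih =>
      have hσ : StronglyMeasurable[ℱ n] fun ω =>
          runMax g n ω ^ (p - 1) * (if 0 ≤ g n ω then (1 : ℝ) else -1) := by
        refine Measurable.stronglyMeasurable ?_
        refine Measurable.mul ((hMm n).pow_const (p - 1)) ?_
        exact Measurable.ite (measurableSet_le measurable_const (hg.1 n).measurable)
          measurable_const measurable_const
      have hσi : Integrable (fun ω => (runMax g n ω ^ (p - 1) *
          (if 0 ≤ g n ω then (1 : ℝ) else -1)) * (g (n + 1) ω - g n ω)) μ :=
        integrable_of_abs_le_rpow_mul hp zero_le_one (hMp n) ((hgp (n + 1)).sub (hgp n))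
          ((hσ.mono (ℱ.le n)).aestronglyMeasurable.mul ((hgp (n + 1)).sub (hgp n)).1) fun ω => by
            have : |(if 0 ≤ g n ω then (1 : ℝ) else -1)| = 1 := by split_ifs <;> simp
            rw [one_mul, abs_mul, abs_mul, this, abs_of_nonneg (hM0 n ω), mul_one,
              abs_of_nonneg (Real.rpow_nonneg (hM0 n ω) _)]
            rfl
      have h0 := integral_mul_sub_eq_zero hg n hσ hσi
      calc ∫ ω, (runMax g (n + 1) ω ^ p
            - C * (runMax g (n + 1) ω ^ (p - 1) * |g (n + 1) ω|)) ∂μ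
          ≤ ∫ ω, (runMax g n ω ^ p - C * (runMax g n ω ^ (p - 1) * |g n ω|))
              - C * ((runMax g n ω ^ (p - 1) * (if 0 ≤ g n ω then (1 : ℝ) else -1))
                * (g (n + 1) ω - g n ω)) ∂μ := by
            refine integral_mono (hD (n + 1) (n + 1)) ((hD n n).sub (hσi.const_mul C)) fun ω => ?_
            set z := runMax g n ω with hz
            have hz0 : 0 ≤ z := hM0 n ω
            set σ : ℝ := if 0 ≤ g n ω then (1 : ℝ) else -1 with hσ'
            have hσ1 : |g n ω| + σ * (g (n + 1) ω - g n ω) ≤ |g (n + 1) ω| := by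
              rw [hσ']
              split_ifs with h
              · rw [abs_of_nonneg h]; linarith [le_abs_self (g (n + 1) ω)]
              · rw [abs_of_neg (not_le.1 h)]; linarith [neg_le_abs (g (n + 1) ω)]
            have hstep : z ^ p - C * (z ^ (p - 1) * |g (n + 1) ω|)
                ≤ z ^ p - C * (z ^ (p - 1) * |g n ω|)
                  - C * (z ^ (p - 1) * σ * (g (n + 1) ω - g n ω)) := by
              have := mul_le_mul_of_nonneg_left hσ1
                (mul_nonneg hC0.le (Real.rpow_nonneg hz0 (p - 1)))
              linarith
            refine le_trans ?_ hstep
            change (max z |g (n + 1) ω|) ^ p - C * ((max z |g (n + 1) ω|) ^ (p - 1)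
              * |g (n + 1) ω|) ≤ _
            rcases le_total |g (n + 1) ω| z with h | h
            · rw [max_eq_left h]
            · rw [max_eq_right h, ← rpow_eq_rpow_sub_one_mul hp (abs_nonneg _)]
              -- At a new maximum, Young's inequality multiplied by `C - 1 = 1 / (p - 1)` is exactly
              -- what is needed.
              have hy := mul_rpow_mul_le hp hz0 (abs_nonneg (g (n + 1) ω))
              have e : C * (p - 1) = p := by rw [hC]; field_simp
              have e2 : (C - 1) * (p - 1) = 1 := by rw [sub_mul, e]; ring
              have e3 : 0 < C - 1 := by nlinarith
              have := mul_le_mul_of_nonneg_left hy e3.le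
              have e4 : (C - 1) * p = C := by linear_combination e
              linear_combination this - (z ^ (p - 1) * |g (n + 1) ω|) * e4 + z ^ p * e2
        _ = ∫ ω, (runMax g n ω ^ p - C * (runMax g n ω ^ (p - 1) * |g n ω|)) ∂μ := by
            rw [integral_sub (hD n n) (hσi.const_mul C), integral_const_mul, h0, mul_zero, sub_zero]
        _ ≤ 0 := ih
  have hfin : ∫ ω, (p * (runMax g n ω ^ p - C * (runMax g n ω ^ (p - 1) * |g n ω|))) ∂μ
      ≥ ∫ ω, (runMax g n ω ^ p - C ^ p * |g n ω| ^ p) ∂μ := by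
    refine integral_mono ((hMi n).sub ((integrable_abs_rpow hp (hgp n)).const_mul _))
      ((hD n n).const_mul p) fun ω => ?_
    -- Young again, now with `C * |g n|` as second factor, separates the mixed term.
    have hy := mul_rpow_mul_le hp (hM0 n ω) (mul_nonneg hC0.le (abs_nonneg (g n ω)))
    rw [Real.mul_rpow hC0.le (abs_nonneg _)] at hy
    change runMax g n ω ^ p - C ^ p * |g n ω| ^ p
      ≤ p * (runMax g n ω ^ p - C * (runMax g n ω ^ (p - 1) * |g n ω|))
    linarith
  rw [integral_const_mul, integral_sub (hMi n) ((integrable_abs_rpow hp (hgp n)).const_mul _),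
    integral_const_mul] at hfin
  simp only [abs_of_nonneg (hM0 n _)]
  nlinarith

/-- The maximal inequality with constant `p` for differentially subordinate martingales. -/
theorem maxNorm_le_of_diffSubordinate (hp : 2 ≤ p) (hf : Martingale f ℱ μ)
    (hg : Martingale g ℱ μ) (hs : DiffSubordinate μ g f) :
    maxNorm μ p g ≤ ENNReal.ofReal p * processNorm μ p f := by
  have hp0 : 0 < p := by linarith
  have hp1 : 0 < p - 1 := by linarith
  rcases eq_or_ne (processNorm μ p f) ∞ with htop | htop
  · rw [htop, ENNReal.mul_top (by simp; linarith)]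
    exact le_top
  have hfp : ∀ n, MemLp (f n) (ENNReal.ofReal p) μ := fun n =>
    ⟨((hf.1 n).mono (ℱ.le n)).aestronglyMeasurable,
      (le_iSup (fun n => eLpNorm (f n) (ENNReal.ofReal p) μ) n).trans_lt htop.lt_top⟩
  have hgp := memLp_of_diffSubordinate hfp
    (fun n => ((hg.1 n).mono (ℱ.le n)).aestronglyMeasurable) hs
  refine maxNorm_le_of_eLpNorm_runMax_le hp
    (fun n => (measurable_runMax (fun n => (hg.1 n).measurable) n).mono (ℱ.le n) le_rfl)
    fun n => ?_
  refine (eLpNorm_le_mul_of_integral_rpow_le hp hp0.le (hfp n) (memLp_runMax hgp n) ?_).trans ?_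
  · refine (integral_runMax_rpow_le hp hg hgp n).trans ?_
    have h := mul_le_mul_of_nonneg_left
      (integral_rpow_le_of_diffSubordinate hp hf hg hs hfp hgp n)
      (show 0 ≤ (p / (p - 1)) ^ p by positivity)
    rwa [← mul_assoc, ← Real.mul_rpow (by positivity) hp1.le, div_mul_cancel₀ _ hp1.ne'] at h
  · gcongr
    exact le_iSup (fun n => eLpNorm (f n) (ENNReal.ofReal p) μ) n

theorem martingale_sum_mul_mdiff (hf : Martingale f ℱ μ) (v : ℕ → ℝ) :
    Martingale (fun n ω => ∑ k ∈ Finset.range (n + 1), v k * mdiff f k ω) ℱ μ := by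
  have hsucc : ∀ n, (fun ω => ∑ k ∈ Finset.range (n + 1 + 1), v k * mdiff f k ω)
      = (fun ω => ∑ k ∈ Finset.range (n + 1), v k * mdiff f k ω)
        + v (n + 1) • (f (n + 1) - f n) := by
    intro n
    ext ω
    rw [Finset.sum_range_succ]
    rfl
  refine martingale_of_condExp_sub_eq_zero_nat ?_ ?_ ?_
  · intro n
    induction n with
    | zero => simpa [mdiff] using (hf.1 0).const_mul (v 0)
    | succ n ih =>
      beta_reduce
      rw [hsucc]
      exact (ih.mono (ℱ.mono (Nat.le_succ n))).add
        (((hf.1 (n + 1)).sub ((hf.1 n).mono (ℱ.mono (Nat.le_succ n)))).const_smul _)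
  · intro n
    induction n with
    | zero => simpa [mdiff] using (hf.integrable 0).const_mul (v 0)
    | succ n ih =>
      rw [hsucc]
      exact ih.add (((hf.integrable (n + 1)).sub (hf.integrable n)).smul _)
  · intro n
    rw [hsucc, add_sub_cancel_left]
    filter_upwards [condExp_smul (v (n + 1)) (f (n + 1) - f n) (ℱ n) (μ := μ),
      condExp_sub (hf.integrable (n + 1)) (hf.integrable n) (ℱ n),
      hf.2 n (n + 1) (Nat.le_succ n), hf.2 n n le_rfl] with ω a b c d
    rw [a, Pi.smul_apply, b, Pi.sub_apply, c, d, sub_self, smul_zero, Pi.zero_apply]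

theorem maxNorm_le_of_isSignTransform (hp : 2 ≤ p) (hf : Martingale f ℱ μ)
    (hs : IsSignTransform μ g f) :
    maxNorm μ p g ≤ ENNReal.ofReal p * maxNorm μ p f := by
  obtain ⟨v, hv, hgv⟩ := hs
  -- `g` is only known up to null sets and need not be adapted; this exact transform is a martingale
  -- and agrees with it at all times off one null set.
  set g' : ℕ → Ω → ℝ := fun n ω => ∑ k ∈ Finset.range (n + 1), v k * mdiff f k ω with hg'
  have hd : ∀ n ω, mdiff g' n ω = v n * mdiff f n ω := by
    intro n ω
    cases n with
    | zero => simp [mdiff, hg']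
    | succ n =>
      change g' (n + 1) ω - g' n ω = _
      simp only [hg']
      rw [Finset.sum_range_succ, add_sub_cancel_left]
  have hgg' : ∀ᵐ ω ∂μ, ∀ n, g n ω = g' n ω := by
    filter_upwards [ae_all_iff.2 hgv] with ω h n
    rw [← sum_mdiff g n ω]
    exact Finset.sum_congr rfl fun k _ => h k
  have hmax : maxNorm μ p g = maxNorm μ p g' := by
    refine eLpNorm_congr_ae ?_
    filter_upwards [hgg'] with ω h
    simp only [maxFun, h]
  rw [hmax]
  refine (maxNorm_le_of_diffSubordinate hp hf (martingale_sum_mul_mdiff hf v)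
    (IsSignTransform.diffSubordinate
      ⟨v, hv, fun n => Filter.Eventually.of_forall (hd n)⟩)).trans ?_
  gcongr
  exact processNorm_le_maxNorm

end Bounds

/-! ### Intermediate values of non-atomic measures -/

section NonAtomic

variable {Ω : Type*} [MeasurableSpace Ω] {μ : Measure Ω} [IsFiniteMeasure μ]

theorem NonAtomic.exists_measureReal_le_half (h : NonAtomic μ) {s : Set Ω} (hs : MeasurableSet s)
    (h0 : 0 < μ.real s) : ∃ t ⊆ s, MeasurableSet t ∧ 0 < μ.real t ∧ μ.real t ≤ μ.real s / 2 := by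
  obtain ⟨t, hts, ht, ht0, hlt⟩ := h s hs (ENNReal.toReal_pos_iff.1 h0).1
  have h1 : 0 < μ.real t := ENNReal.toReal_pos ht0.ne' (measure_ne_top _ _)
  have h2 : μ.real t < μ.real s :=
    (ENNReal.toReal_lt_toReal (measure_ne_top _ _) (measure_ne_top _ _)).2 hlt
  have h3 : μ.real (s \ t) = μ.real s - μ.real t := measureReal_sdiff hts ht
  rcases le_total (μ.real t) (μ.real s / 2) with h4 | h4
  · exact ⟨t, hts, ht, h1, h4⟩
  · exact ⟨s \ t, Set.sdiff_subset, hs.diff ht, by linarith, by linarith⟩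

theorem NonAtomic.exists_measureReal_le (h : NonAtomic μ) {s : Set Ω} (hs : MeasurableSet s)
    (h0 : 0 < μ.real s) {c : ℝ} (hc : 0 < c) :
    ∃ t ⊆ s, MeasurableSet t ∧ 0 < μ.real t ∧ μ.real t ≤ c := by
  have key : ∀ n : ℕ, ∃ t ⊆ s, MeasurableSet t ∧ 0 < μ.real t ∧
      μ.real t ≤ μ.real s * (1 / 2) ^ n := by
    intro n
    induction n with
    | zero => exact ⟨s, subset_rfl, hs, h0, by simp⟩
    | succ n ih =>
      obtain ⟨t, hts, ht, ht0, hle⟩ := ih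
      obtain ⟨u, hut, hu, hu0, hule⟩ := h.exists_measureReal_le_half ht ht0
      exact ⟨u, hut.trans hts, hu, hu0, by rw [pow_succ]; linarith⟩
  obtain ⟨n, hn⟩ := exists_pow_lt_of_lt_one (div_pos hc h0) (by norm_num : (1 / 2 : ℝ) < 1)
  obtain ⟨t, hts, ht, ht0, hle⟩ := key n
  rw [lt_div_iff₀ h0] at hn
  exact ⟨t, hts, ht, ht0, by linarith⟩

/-- **Sierpiński's theorem**: a non-atomic finite measure takes all intermediate values. -/
theorem NonAtomic.exists_measureReal_eq (h : NonAtomic μ) {s : Set Ω} (hs : MeasurableSet s)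
    {c : ℝ} (hc : 0 ≤ c) (hcs : c ≤ μ.real s) :
    ∃ t ⊆ s, MeasurableSet t ∧ μ.real t = c := by
  let X := {t : Set Ω // MeasurableSet t ∧ t ⊆ s ∧ μ.real t ≤ c}
  -- Greedy exhaustion: add a set with at least half the largest measure that still fits under `c`.
  have step : ∀ x : X, ∃ y : X, x.1 ⊆ y.1 ∧ ∀ B : Set Ω, MeasurableSet B → B ⊆ s \ x.1 →
      μ.real x.1 + μ.real B ≤ c → μ.real B ≤ 2 * (μ.real y.1 - μ.real x.1) := by
    rintro ⟨x, hx, hxs, hxc⟩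
    let V : Set ℝ := {a | ∃ B, MeasurableSet B ∧ B ⊆ s \ x ∧ μ.real x + μ.real B ≤ c ∧
      μ.real B = a}
    have hVb : BddAbove V := ⟨c - μ.real x, by rintro a ⟨B, -, -, hB, rfl⟩; linarith⟩
    have hV0 : (0 : ℝ) ∈ V := ⟨∅, MeasurableSet.empty, Set.empty_subset _, by simpa using hxc,
      by simp⟩
    have hs0 : 0 ≤ sSup V := le_csSup hVb hV0
    obtain ⟨B, hB, hBs, hBc, hB2⟩ : ∃ B, MeasurableSet B ∧ B ⊆ s \ x ∧ μ.real x + μ.real B ≤ c ∧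
        sSup V ≤ 2 * μ.real B := by
      rcases hs0.eq_or_lt with h1 | h1
      · exact ⟨∅, MeasurableSet.empty, Set.empty_subset _, by simpa using hxc, by simp [← h1]⟩
      · obtain ⟨_, ⟨B, hB, hBs, hBc, rfl⟩, hlt⟩ := exists_lt_of_lt_csSup ⟨0, hV0⟩ (half_lt_self h1)
        exact ⟨B, hB, hBs, hBc, by linarith⟩
    have hdisj : Disjoint x B := (Set.disjoint_sdiff_right).mono_right hBs
    have hU : μ.real (x ∪ B) = μ.real x + μ.real B := measureReal_union hdisj hB
    refine ⟨⟨x ∪ B, hx.union hB, Set.union_subset hxs (hBs.trans Set.sdiff_subset), by rwa [hU]⟩,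
      Set.subset_union_left, fun E hE hEs hEc => ?_⟩
    rw [hU, add_sub_cancel_left]
    exact (le_csSup hVb ⟨E, hE, hEs, hEc, rfl⟩).trans hB2
  choose next hsub hnext using step
  let t : ℕ → X := fun n => Nat.rec ⟨∅, MeasurableSet.empty, Set.empty_subset _, by simpa⟩
    (fun _ x => next x) n
  have ht : ∀ n, t (n + 1) = next (t n) := fun n => rfl
  have hmono : Monotone fun n => (t n).1 := monotone_nat_of_le_succ fun n => hsub (t n)
  have hTm : MeasurableSet (⋃ n, (t n).1) := MeasurableSet.iUnion fun n => (t n).2.1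
  have hTs : (⋃ n, (t n).1) ⊆ s := Set.iUnion_subset fun n => (t n).2.2.1
  have hlim : Filter.Tendsto (fun n => μ.real (t n).1) Filter.atTop
      (nhds (μ.real (⋃ n, (t n).1))) :=
    (ENNReal.tendsto_toReal (measure_ne_top _ _)).comp (tendsto_measure_iUnion_atTop hmono)
  have hTc : μ.real (⋃ n, (t n).1) ≤ c := le_of_tendsto' hlim fun n => (t n).2.2.2
  refine ⟨_, hTs, hTm, hTc.antisymm ?_⟩
  by_contra! hlt
  -- If the union fell short of `c`, this `B` would fit at every stage, so each increment would be
  -- at least `μ.real B / 2`, although the increments tend to zero.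
  obtain ⟨B, hBs, hB, hB0, hBc⟩ := h.exists_measureReal_le (hs.diff hTm)
    (by rw [measureReal_sdiff hTs hTm]; linarith) (sub_pos.2 hlt)
  have hle : ∀ n, μ.real B ≤ 2 * (μ.real (t (n + 1)).1 - μ.real (t n).1) := fun n => by
    have hsubT : (t n).1 ⊆ ⋃ n, (t n).1 := Set.subset_iUnion (fun n => (t n).1) n
    rw [ht]
    refine hnext (t n) B hB (hBs.trans (Set.sdiff_subset_sdiff_right hsubT)) ?_
    have := measureReal_mono (μ := μ) hsubT
    linarith
  have hlim2 := (((Filter.tendsto_add_atTop_iff_nat 1).2 hlim).sub hlim).const_mul 2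
  have := ge_of_tendsto' hlim2 hle
  linarith

theorem NonAtomic.exists_antitone_measureReal_eq_pow [IsProbabilityMeasure μ] (h : NonAtomic μ)
    {ρ : ℝ} (h0 : 0 ≤ ρ) (h1 : ρ ≤ 1) :
    ∃ A : ℕ → Set Ω, A 0 = Set.univ ∧ (∀ n, MeasurableSet (A n)) ∧ Antitone A ∧
      ∀ n, μ.real (A n) = ρ ^ n := by
  have step : ∀ x : {A : Set Ω // MeasurableSet A}, ∃ y : {A : Set Ω // MeasurableSet A},
      y.1 ⊆ x.1 ∧ μ.real y.1 = μ.real x.1 * ρ := by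
    rintro ⟨x, hx⟩
    obtain ⟨y, hyx, hy, he⟩ := h.exists_measureReal_eq hx (c := μ.real x * ρ) (by positivity)
      (mul_le_of_le_one_right (by positivity) h1)
    exact ⟨⟨y, hy⟩, hyx, he⟩
  choose next hsub hnext using step
  let A : ℕ → {A : Set Ω // MeasurableSet A} := fun n => Nat.rec ⟨Set.univ, MeasurableSet.univ⟩
    (fun _ x => next x) n
  refine ⟨fun n => (A n).1, rfl, fun n => (A n).2, antitone_nat_of_succ_le fun n => hsub (A n),
    fun n => ?_⟩
  induction n with
  | zero => simp [A]
  | succ n ih =>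
    rw [pow_succ, ← ih]
    exact hnext (A n)

end NonAtomic

/-! ### The extremal paths -/

section AtomProcess

variable {Ω : Type*}

/-- The increment equal to `a` on `A (n + 1)`, to `-b` on `A n \ A (n + 1)`, and to `0`
elsewhere. -/
noncomputable def atomStep (A : ℕ → Set Ω) (a b : ℝ) (n : ℕ) (ω : Ω) : ℝ :=
  (A (n + 1)).indicator (fun _ => a + b) ω - (A n).indicator (fun _ => b) ω

theorem atomStep_of_mem {A : ℕ → Set Ω} (hA : Antitone A) {a b : ℝ} {n : ℕ} {ω : Ω}
    (h : ω ∈ A (n + 1)) : atomStep A a b n ω = a := by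
  simp [atomStep, h, hA (Nat.le_succ n) h]

theorem atomStep_of_mem_of_notMem {A : ℕ → Set Ω} {a b : ℝ} {n : ℕ} {ω : Ω}
    (h : ω ∈ A n) (h' : ω ∉ A (n + 1)) : atomStep A a b n ω = -b := by
  simp [atomStep, h, h']

theorem atomStep_of_notMem {A : ℕ → Set Ω} (hA : Antitone A) {a b : ℝ} {n : ℕ} {ω : Ω}
    (h : ω ∉ A n) : atomStep A a b n ω = 0 := by
  have h' : ω ∉ A (n + 1) := fun h' => h (hA (Nat.le_succ n) h')
  simp [atomStep, h, h']

theorem abs_atomStep_le {A : ℕ → Set Ω} (hA : Antitone A) {a b : ℝ} (ha : 0 ≤ a) (hb : 0 ≤ b)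
    (n : ℕ) (ω : Ω) : |atomStep A a b n ω| ≤ a + b := by
  by_cases h : ω ∈ A n
  · by_cases h' : ω ∈ A (n + 1)
    · rw [atomStep_of_mem hA h', abs_of_nonneg ha]; linarith
    · rw [atomStep_of_mem_of_notMem h h', abs_neg, abs_of_nonneg hb]; linarith
  · rw [atomStep_of_notMem hA h, abs_zero]; linarith

/-- The process started at `1` with the increments `w n * atomStep A a b n`. -/
noncomputable def atomPath (A : ℕ → Set Ω) (a b : ℝ) (w : ℕ → ℝ) (n : ℕ) (ω : Ω) : ℝ :=
  1 + ∑ k ∈ Finset.range n, w k * atomStep A a b k ω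

theorem atomPath_succ (A : ℕ → Set Ω) (a b : ℝ) (w : ℕ → ℝ) (n : ℕ) (ω : Ω) :
    atomPath A a b w (n + 1) ω = atomPath A a b w n ω + w n * atomStep A a b n ω := by
  rw [atomPath, atomPath, Finset.sum_range_succ, add_assoc]

theorem atomPath_pow_of_mem {A : ℕ → Set Ω} (hA : Antitone A) (a b : ℝ) {n : ℕ} {ω : Ω}
    (h : ω ∈ A n) : atomPath A a b (fun k => (1 + a) ^ k) n ω = (1 + a) ^ n := by
  induction n with
  | zero => simp [atomPath]
  | succ n ih =>
    rw [atomPath_succ, ih (hA (Nat.le_succ n) h), atomStep_of_mem hA h]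
    ring

/-- On `A n` the path is a geometric sum of ratio `-(1 + a)`; multiplying by `2 + a` gives the
closed form. Cancellation keeps it of the order of one increment. -/
theorem abs_atomPath_alternating_of_mem {A : ℕ → Set Ω} (hA : Antitone A) {a b : ℝ}
    (ha : 0 ≤ a) {n : ℕ} {ω : Ω} (h : ω ∈ A n) :
    |atomPath A a b (fun k => (-1) ^ k * (1 + a) ^ k) n ω - 1| ≤ a * (1 + a) ^ n := by
  have e : (2 + a) * (atomPath A a b (fun k => (-1) ^ k * (1 + a) ^ k) n ω - 1)
      = a * (1 - (-1) ^ n * (1 + a) ^ n) := by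
    induction n with
    | zero => simp [atomPath]
    | succ n ih =>
      rw [atomPath_succ, atomStep_of_mem hA h]
      linear_combination ih (hA (Nat.le_succ n) h)
  have h1 : 1 ≤ (1 + a) ^ n := one_le_pow₀ (by linarith)
  have h2 : |1 - (-1) ^ n * (1 + a) ^ n| ≤ (2 + a) * (1 + a) ^ n := by
    rcases neg_one_pow_eq_or ℝ n with h | h <;> rw [h, abs_le] <;> constructor <;> nlinarith
  have h3 := congrArg abs e
  rw [abs_mul, abs_mul, abs_of_nonneg ha, abs_of_nonneg (show 0 ≤ 2 + a by linarith)] at h3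
  have h4 := mul_le_mul_of_nonneg_left h2 ha
  refine le_of_mul_le_mul_left (a := 2 + a) ?_ (by linarith)
  linarith

/-- Inside `A n` the deviation from `1` is at most `a * (1 + a) ^ n`, leaving costs a further `b *
(1 + a) ^ n`, and then the path is frozen. The time `m` is the last one inside, because the unsigned
path itself drops on leaving. -/
theorem exists_abs_atomPath_alternating_le {A : ℕ → Set Ω} (hA : Antitone A)
    (hA0 : A 0 = Set.univ) {a b : ℝ}
    (ha : 0 ≤ a) (hb : 0 ≤ b) (n : ℕ) (ω : Ω) :
    ∃ m ≤ n, |atomPath A a b (fun k => (-1) ^ k * (1 + a) ^ k) n ω|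
      ≤ 1 + (a + b) * |atomPath A a b (fun k => (1 + a) ^ k) m ω| := by
  have hpos : ∀ n, 0 ≤ (1 + a) ^ n := fun n => by positivity
  have hmem : ∀ n, ω ∈ A n → |atomPath A a b (fun k => (-1) ^ k * (1 + a) ^ k) n ω|
      ≤ 1 + a * (1 + a) ^ n := fun n h => by
    have h1 := abs_atomPath_alternating_of_mem hA (b := b) ha h
    have h2 := abs_add_le (atomPath A a b (fun k => (-1) ^ k * (1 + a) ^ k) n ω - 1) 1
    rw [sub_add_cancel, abs_one] at h2
    linarith
  have halive : ∀ n, ω ∈ A n → ∃ m ≤ n,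
      |atomPath A a b (fun k => (-1) ^ k * (1 + a) ^ k) n ω|
      ≤ 1 + (a + b) * |atomPath A a b (fun k => (1 + a) ^ k) m ω| := fun n h => by
    refine ⟨n, le_rfl, (hmem n h).trans ?_⟩
    rw [atomPath_pow_of_mem hA a b h, abs_of_nonneg (hpos n)]
    nlinarith [mul_nonneg hb (hpos n)]
  induction n with
  | zero => exact halive 0 (hA0 ▸ Set.mem_univ ω)
  | succ n ih =>
    by_cases h' : ω ∈ A (n + 1)
    · exact halive (n + 1) h'
    by_cases h : ω ∈ A n
    · refine ⟨n, Nat.le_succ n, ?_⟩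
      rw [atomPath_pow_of_mem hA a b h, abs_of_nonneg (hpos n), atomPath_succ,
        atomStep_of_mem_of_notMem h h']
      refine (abs_add_le _ _).trans ?_
      have h1 : |(-1) ^ n * (1 + a) ^ n * -b| = (1 + a) ^ n * b := by
        rw [abs_mul, abs_mul, abs_pow, abs_neg, abs_neg, abs_one, one_pow, one_mul,
          abs_of_nonneg hb, abs_of_nonneg (hpos n)]
      rw [h1]
      linarith [hmem n h]
    · obtain ⟨m, hm, hle⟩ := ih
      exact ⟨m, hm.trans (Nat.le_succ n), by
        rwa [atomPath_succ, atomStep_of_notMem hA h, mul_zero, add_zero]⟩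

theorem abs_atomPath_pow_le {A : ℕ → Set Ω} (hA : Antitone A) {a b : ℝ}
    (ha : 0 ≤ a) (hb : 0 ≤ b) {n N : ℕ} (hn : n ≤ N) (ω : Ω) :
    |atomPath A a b (fun k => (1 + a) ^ k) n ω|
      ≤ 1 + ∑ k ∈ Finset.range N, (1 + a) ^ k * (a + b) := by
  refine (abs_add_le _ _).trans ?_
  rw [abs_one]
  gcongr
  refine (Finset.abs_sum_le_sum_abs _ _).trans ?_
  refine (Finset.sum_le_sum fun k _ => ?_).trans
    (Finset.sum_le_sum_of_subset_of_nonneg (Finset.range_subset_range.2 hn) fun k _ _ => ?_)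
  · rw [abs_mul, abs_of_nonneg (show 0 ≤ (1 + a) ^ k by positivity)]
    exact mul_le_mul_of_nonneg_left (abs_atomStep_le hA ha hb k ω) (by positivity)
  · positivity

end AtomProcess

/-! ### Sharpness: the martingales and the choice of parameters -/

section Example

variable {Ω : Type*} [m0 : MeasurableSpace Ω]

/-- The filtration of a decreasing sequence of events `A n`: at time `n`, the part of the space
inside `A n` is not resolved. -/
def atomFiltration (A : ℕ → Set Ω) (hA : Antitone A) : Filtration ℕ m0 where
  seq n :=
    { MeasurableSet' := fun S => MeasurableSet S ∧ (A n ⊆ S ∨ A n ⊆ Sᶜ)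
      measurableSet_empty := ⟨MeasurableSet.empty, Or.inr (by simp)⟩
      measurableSet_compl := fun S hS => ⟨hS.1.compl, by rw [compl_compl]; exact hS.2.symm⟩
      measurableSet_iUnion := fun S hS => by
        refine ⟨MeasurableSet.iUnion fun i => (hS i).1, ?_⟩
        by_cases h : ∃ i, A n ⊆ S i
        · obtain ⟨i, hi⟩ := h
          exact Or.inl (hi.trans (Set.subset_iUnion S i))
        · push Not at h
          refine Or.inr ?_
          rw [Set.compl_iUnion]
          exact Set.subset_iInter fun i => (hS i).2.resolve_left (h i) }
  mono' := fun _ _ hij _ hS =>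
    ⟨hS.1, hS.2.imp (fun h => (hA hij).trans h) fun h => (hA hij).trans h⟩
  le' := fun _ _ hS => hS.1

theorem measurableSet_atomFiltration {A : ℕ → Set Ω} (hA : Antitone A)
    (hm : ∀ n, MeasurableSet (A n)) {k n : ℕ} (hkn : k ≤ n) :
    MeasurableSet[atomFiltration A hA n] (A k) :=
  ⟨hm k, Or.inl (hA hkn)⟩

theorem measurable_atomStep {A : ℕ → Set Ω} (hA : Antitone A) (hm : ∀ n, MeasurableSet (A n))
    (a b : ℝ) {k n : ℕ} (hkn : k < n) : Measurable[atomFiltration A hA n] (atomStep A a b k) :=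
  (measurable_const.indicator (measurableSet_atomFiltration hA hm hkn)).sub
    (measurable_const.indicator (measurableSet_atomFiltration hA hm hkn.le))

theorem measurable_atomPath {A : ℕ → Set Ω} (hA : Antitone A) (hm : ∀ n, MeasurableSet (A n))
    (a b : ℝ) (w : ℕ → ℝ) (n : ℕ) :
    Measurable[atomFiltration A hA n] (atomPath A a b w n) := by
  unfold atomPath
  refine measurable_const.add (Finset.measurable_sum _ fun k hk => ?_)
  exact (measurable_atomStep hA hm a b (Finset.mem_range.1 hk)).const_mul _

/-- An event known at time `n` either contains `A n`, where gain and loss balance by `hab`, or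
misses it, where the increment vanishes. -/
theorem martingale_atomPath {μ : Measure Ω} [IsProbabilityMeasure μ] {A : ℕ → Set Ω}
    (hA : Antitone A) (hm : ∀ n, MeasurableSet (A n)) {a b : ℝ}
    (hab : ∀ n, (a + b) * μ.real (A (n + 1)) = b * μ.real (A n)) (w : ℕ → ℝ) :
    Martingale (atomPath A a b w) (atomFiltration A hA) μ := by
  have hs1 : ∀ n c, Integrable ((A n).indicator fun _ => (c : ℝ)) μ := fun n c =>
    (integrable_const c).indicator (hm n)
  have hs : ∀ n, Integrable (atomStep A a b n) μ := fun n => (hs1 _ _).sub (hs1 _ _)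
  have hi : ∀ n, Integrable (atomPath A a b w n) μ := fun n =>
    (integrable_const 1).add (integrable_finsetSum _ fun k _ => (hs k).const_mul _)
  refine martingale_of_setIntegral_eq_succ
    (fun n => (measurable_atomPath hA hm a b w n).stronglyMeasurable) hi fun n S hS => ?_
  simp only [atomPath_succ]
  rw [integral_add (hi n).integrableOn ((hs n).const_mul _).integrableOn, integral_const_mul]
  have h0 : ∫ ω in S, atomStep A a b n ω ∂μ = 0 := by
    rcases hS.2 with h | h
    · have e : ∀ k c, n ≤ k → ∫ ω in S, (A k).indicator (fun _ => (c : ℝ)) ω ∂μ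
          = c * μ.real (A k) := by
        intro k c hk
        rw [setIntegral_indicator (hm k), setIntegral_const,
          Set.inter_eq_right.2 ((hA hk).trans h), smul_eq_mul, mul_comm]
      simp only [atomStep]
      rw [integral_sub (hs1 _ _).integrableOn (hs1 _ _).integrableOn, e _ _ (Nat.le_succ n),
        e _ _ le_rfl, hab, sub_self]
    · refine setIntegral_eq_zero_of_forall_eq_zero fun ω hω => ?_
      exact atomStep_of_notMem hA fun h' => h h' hω
  rw [h0, mul_zero, add_zero]

theorem MeasureTheory.Martingale.min_const {μ : Measure Ω} [IsProbabilityMeasure μ] {ℱ : Filtration ℕ m0}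
    {f : ℕ → Ω → ℝ} (hf : Martingale f ℱ μ) (N : ℕ) : Martingale (fun n => f (min n N)) ℱ μ := by
  refine martingale_nat (fun n => (hf.1 (min n N)).mono (ℱ.mono (min_le_left n N)))
    (fun n => hf.integrable _) fun n => ?_
  rcases lt_or_ge n N with h | h
  · simp only [min_eq_left h.le, min_eq_left (Nat.succ_le_of_lt h)]
    exact (hf.2 n (n + 1) (Nat.le_succ n)).symm
  · simp only [min_eq_right h, min_eq_right (h.trans (Nat.le_succ n))]
    rw [condExp_of_stronglyMeasurable (ℱ.le n) ((hf.1 N).mono (ℱ.mono h)) (hf.integrable N)]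

theorem isSignTransform_atomPath (μ : Measure Ω) (A : ℕ → Set Ω) (a b : ℝ) (N : ℕ)
    {w w' v : ℕ → ℝ} (hv : ∀ n, v n = 1 ∨ v n = -1) (hw : ∀ n, w' n = v n * w n) :
    IsSignTransform μ (fun n => atomPath A a b w' (min n N))
      (fun n => atomPath A a b w (min n N)) := by
  -- Both paths start at `1`, so the first sign is `1` and the signs `v` are shifted by one.
  refine ⟨fun n => Nat.casesOn n 1 v, fun n => ?_, fun n => Filter.Eventually.of_forall fun ω => ?_⟩
  · cases n with
    | zero => exact Or.inl rfl
    | succ n => exact hv n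
  · cases n with
    | zero => simp [mdiff, atomPath]
    | succ n =>
      simp only [mdiff]
      rcases lt_or_ge n N with h | h
      · rw [min_eq_left h.le, min_eq_left (Nat.succ_le_of_lt h), atomPath_succ,
          atomPath_succ, hw]
        ring
      · simp [min_eq_right h, min_eq_right (h.trans (Nat.le_succ n))]

theorem measurable_maxFun {f : ℕ → Ω → ℝ} (hf : ∀ n, Measurable (f n)) : Measurable (maxFun f) :=
  Measurable.iSup fun n => (measurable_abs.comp (hf n)).ennreal_ofReal

theorem maxNorm_le_of_maxFun_le {μ : Measure Ω} [IsProbabilityMeasure μ] {p : ℝ} (hp : 2 ≤ p)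
    {f g : ℕ → Ω → ℝ} (hg : ∀ n, Measurable (g n)) {c : ℝ}
    (h : ∀ ω, maxFun f ω ≤ 1 + ENNReal.ofReal c * maxFun g ω) :
    maxNorm μ p f ≤ 1 + ENNReal.ofReal c * maxNorm μ p g := by
  have hP1 : 1 ≤ ENNReal.ofReal p := by
    rw [← ENNReal.ofReal_one]; exact ENNReal.ofReal_le_ofReal (by linarith)
  have hm := measurable_maxFun hg
  calc maxNorm μ p f
      ≤ eLpNorm ((fun _ => (1 : ℝ≥0∞)) + fun ω => ENNReal.ofReal c * maxFun g ω)
          (ENNReal.ofReal p) μ := eLpNorm_mono_enorm h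
    _ ≤ eLpNorm (fun _ => (1 : ℝ≥0∞)) (ENNReal.ofReal p) μ
          + eLpNorm (fun ω => ENNReal.ofReal c * maxFun g ω) (ENNReal.ofReal p) μ :=
        eLpNorm_add_le measurable_const.aestronglyMeasurable
          (hm.const_mul _).aestronglyMeasurable hP1
    _ ≤ 1 + ENNReal.ofReal c * maxNorm μ p g := by
        refine add_le_add (le_of_eq ?_) ?_
        · rw [eLpNorm_const _ (by positivity) (NeZero.ne μ)]
          simp
        · exact eLpNorm_le_nnreal_smul_eLpNorm_of_ae_le_mul'
            (Filter.Eventually.of_forall fun ω => le_rfl) _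

/-- On a non-atomic space the constant `p` in the maximal inequality for `±1` transforms cannot
be replaced by any smaller number. -/
theorem NonAtomic.exists_lt_maxNorm {μ : Measure Ω} [IsProbabilityMeasure μ] (h : NonAtomic μ)
    {p : ℝ} (hp : 2 ≤ p) {r : ℝ} (hr : r < p) :
    ∃ (ℱ : Filtration ℕ m0) (f g : ℕ → Ω → ℝ),
      Martingale f ℱ μ ∧ Martingale g ℱ μ ∧ IsSignTransform μ g f ∧
        ENNReal.ofReal r * maxNorm μ p f < maxNorm μ p g := by
  wlog hr1 : 1 ≤ r generalizing r
  · obtain ⟨ℱ, f, g, hf, hg, hs, hlt⟩ := this (r := 1) (by linarith) le_rfl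
    refine ⟨ℱ, f, g, hf, hg, hs, lt_of_le_of_lt ?_ hlt⟩
    gcongr
    linarith
  have hp0 : 0 < p := by linarith
  obtain ⟨R, hrR, hRp⟩ := exists_between hr
  have hR0 : 0 < R := by linarith
  -- Here `c` becomes `a + b` with `b = 1 / R`: `c < 1 / r` gives `r * (a + b) < 1`, and `R < p`
  -- makes the norm grow.
  obtain ⟨c, hRc, hcr⟩ := exists_between (one_div_lt_one_div_of_lt (by linarith) hrR)
  set b : ℝ := 1 / R with hb
  obtain ⟨a, rfl⟩ : ∃ a, c = a + b := ⟨c - b, by ring⟩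
  have ha : 0 < a := by linarith
  have hb0 : 0 < b := by positivity
  have hbR : b * R = 1 := by rw [hb]; field_simp
  have hrc : r * (a + b) < 1 := by rwa [lt_div_iff₀ (by linarith), mul_comm] at hcr
  set ρ : ℝ := b / (a + b) with hρ
  have hρ0 : 0 < ρ := by positivity
  have hρ1 : ρ ≤ 1 := by rw [hρ, div_le_one (by positivity)]; linarith
  obtain ⟨A, hA0, hm, hA, hμA⟩ := h.exists_antitone_measureReal_eq_pow hρ0.le hρ1
  -- The factor per step in the `L^p` norm of `(1 + a) ^ n` on `A n`. It exceeds `1` because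
  -- Bernoulli gives `(1 + a) ^ p * b ≥ b + p * a * b`, and `p * b > 1`.
  set κ : ℝ := (1 + a) * ρ ^ (1 / p) with hκ
  have hκ0 : 0 < κ := by positivity
  have hκ1 : 1 < κ := by
    by_contra! hle
    have h1 := Real.rpow_le_one hκ0.le hle hp0.le
    rw [hκ, Real.mul_rpow (by positivity) (by positivity), ← Real.rpow_mul hρ0.le,
      one_div_mul_cancel hp0.ne', Real.rpow_one, hρ, mul_div_assoc', div_le_one (by positivity)]
      at h1
    have h2 : 1 + p * a ≤ (1 + a) ^ p :=
      one_add_mul_self_le_rpow_one_add (by linarith) (by linarith)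
    have h3 := mul_le_mul_of_nonneg_right h2 hb0.le
    have h4 : 0 < (p - R) * (a * b) := mul_pos (by linarith) (by positivity)
    have h5 : b * R * a = a := by rw [hbR, one_mul]
    nlinarith
  -- Beyond this threshold a norm `x` of `g*` satisfies `r * (1 + (a + b) * x) < x`.
  obtain ⟨N, hN⟩ := pow_unbounded_of_one_lt (r / (1 - r * (a + b))) hκ1
  have hab : ∀ n, (a + b) * μ.real (A (n + 1)) = b * μ.real (A n) := fun n => by
    rw [hμA, hμA, pow_succ, hρ]
    field_simp
  set f : ℕ → Ω → ℝ := fun n => atomPath A a b (fun k => (-1) ^ k * (1 + a) ^ k) (min n N)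
    with hf
  set g : ℕ → Ω → ℝ := fun n => atomPath A a b (fun k => (1 + a) ^ k) (min n N) with hg
  have hgm : ∀ n, Measurable (g n) := fun n =>
    (measurable_atomPath hA hm a b _ (min n N)).mono ((atomFiltration A hA).le _) le_rfl
  refine ⟨atomFiltration A hA, f, g, (martingale_atomPath hA hm hab _).min_const N,
    (martingale_atomPath hA hm hab _).min_const N,
    isSignTransform_atomPath μ A a b N (v := fun k => (-1) ^ k) (neg_one_pow_eq_or ℝ)
      fun n => ?_, ?_⟩
  · rw [← mul_assoc, ← mul_pow]
    simp
  have hfg : ∀ ω, maxFun f ω ≤ 1 + ENNReal.ofReal (a + b) * maxFun g ω := by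
    refine fun ω => iSup_le fun n => ?_
    obtain ⟨m, hmn, hle⟩ := exists_abs_atomPath_alternating_le hA hA0 ha.le hb0.le (min n N) ω
    refine (ENNReal.ofReal_le_ofReal hle).trans ?_
    rw [ENNReal.ofReal_add zero_le_one (by positivity), ENNReal.ofReal_one,
      ENNReal.ofReal_mul (by positivity)]
    gcongr
    refine le_trans (le_of_eq ?_) (le_iSup (fun n => ENNReal.ofReal |g n ω|) m)
    simp only [hg, min_eq_left (hmn.trans (min_le_right n N))]
  -- Stopping at `N` keeps the norm finite, so the strict comparison can be made in the reals.
  have hfin : maxNorm μ p g ≠ ∞ := by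
    refine ne_top_of_le_ne_top ?_ (eLpNorm_mono_enorm
      (g := fun _ => 1 + ∑ k ∈ Finset.range N, (1 + a) ^ k * (a + b)) fun ω => ?_)
    · exact (memLp_const _).2.ne
    · rw [enorm_eq_self, Real.enorm_of_nonneg (by positivity)]
      exact iSup_le fun n => ENNReal.ofReal_le_ofReal
        (abs_atomPath_pow_le hA ha.le hb0.le (min_le_right n N) ω)
  have hlow : ENNReal.ofReal (κ ^ N) ≤ maxNorm μ p g := by
    have h1 : eLpNorm ((A N).indicator fun _ => (1 + a) ^ N) (ENNReal.ofReal p) μ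
        = ENNReal.ofReal (κ ^ N) := by
      rw [eLpNorm_indicator_const (hm N) (by simpa using hp0) ENNReal.ofReal_ne_top,
        ENNReal.toReal_ofReal hp0.le, Real.enorm_of_nonneg (by positivity),
        ← ofReal_measureReal, hμA, ENNReal.ofReal_rpow_of_pos (by positivity),
        ← ENNReal.ofReal_mul (by positivity), hκ, mul_pow, ← Real.rpow_natCast (ρ ^ (1 / p)),
        ← Real.rpow_mul hρ0.le, ← Real.rpow_natCast ρ, ← Real.rpow_mul hρ0.le, mul_comm (N : ℝ)]
    rw [← h1]
    refine eLpNorm_mono_enorm fun ω => ?_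
    rw [enorm_eq_self]
    by_cases hω : ω ∈ A N
    · rw [Set.indicator_of_mem hω, Real.enorm_eq_ofReal_abs]
      refine le_trans (le_of_eq ?_) (le_iSup (fun n => ENNReal.ofReal |g n ω|) N)
      simp only [hg, min_self, atomPath_pow_of_mem hA a b hω]
    · simp [hω]
  refine (mul_le_mul_right (maxNorm_le_of_maxFun_le hp hgm hfg) _).trans_lt ?_
  obtain ⟨x, hx⟩ : ∃ x : ℝ, x = (maxNorm μ p g).toReal := ⟨_, rfl⟩
  have hx0 : 0 ≤ x := hx ▸ ENNReal.toReal_nonneg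
  have hxG : maxNorm μ p g = ENNReal.ofReal x := by rw [hx, ENNReal.ofReal_toReal hfin]
  rw [hxG] at hlow ⊢
  have hκx : κ ^ N ≤ x := (ENNReal.ofReal_le_ofReal_iff hx0).1 hlow
  have hxr := hN.trans_le hκx
  rw [div_lt_iff₀ (by linarith)] at hxr
  rw [← ENNReal.ofReal_one, ← ENNReal.ofReal_mul (by positivity),
    ← ENNReal.ofReal_add zero_le_one (by positivity), ← ENNReal.ofReal_mul (by linarith)]
  refine (ENNReal.ofReal_lt_ofReal_iff_of_nonneg (by positivity)).2 ?_
  linarith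

end Example

theorem theorem1p3 {Ω : Type*} [MeasurableSpace Ω] (μ : Measure Ω) [IsProbabilityMeasure μ]
    (p : ℝ) (hp : 2 ≤ p) :
    -- the inequality for differentially subordinate martingales
    (∀ (ℱ : Filtration ℕ ‹MeasurableSpace Ω›) (f g : ℕ → Ω → ℝ),
      Martingale f ℱ μ → Martingale g ℱ μ → DiffSubordinate μ g f →
        maxNorm μ p g ≤ ENNReal.ofReal p * processNorm μ p f) ∧
    -- the weaker inequality for sign transforms
    (∀ (ℱ : Filtration ℕ ‹MeasurableSpace Ω›) (f g : ℕ → Ω → ℝ),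
      Martingale f ℱ μ → IsSignTransform μ g f →
        maxNorm μ p g ≤ ENNReal.ofReal p * maxNorm μ p f) ∧
    -- optimality of the constant in both inequalities, on every non-atomic space
    (NonAtomic μ → ∀ r : ℝ, r < p →
      (∃ (ℱ : Filtration ℕ ‹MeasurableSpace Ω›) (f g : ℕ → Ω → ℝ),
        Martingale f ℱ μ ∧ Martingale g ℱ μ ∧ DiffSubordinate μ g f ∧
          ENNReal.ofReal r * processNorm μ p f < maxNorm μ p g) ∧
      (∃ (ℱ : Filtration ℕ ‹MeasurableSpace Ω›) (f g : ℕ → Ω → ℝ),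
        Martingale f ℱ μ ∧ Martingale g ℱ μ ∧ IsSignTransform μ g f ∧
          ENNReal.ofReal r * maxNorm μ p f < maxNorm μ p g)) := by
  refine ⟨fun ℱ f g hf hg hs => maxNorm_le_of_diffSubordinate hp hf hg hs,
    fun ℱ f g hf hs => maxNorm_le_of_isSignTransform hp hf hs, fun hμ r hr => ?_⟩
  have ⟨ℱ, f, g, hf, hg, hs, hlt⟩ := hμ.exists_lt_maxNorm hp hr
  refine ⟨⟨ℱ, f, g, hf, hg, hs.diffSubordinate, lt_of_le_of_lt ?_ hlt⟩, ℱ, f, g, hf, hg, hs, hlt⟩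
  gcongr
  exact processNorm_le_maxNorm
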